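/- Let $\mathcal G,\mathcal H$ be (finite-dimensional, real, smooth) Lie groups with Lie algebras $\mathfrak g=T_e\mathcal G$, $\mathfrak h=T_e\mathcal H$. Let $\Phi:\mathcal G\to\mathrm{Aut}(\mathcal H)$ be a smooth action by group automorphisms (a group homomorphism such that $(g,h)\mapsto\Phi(g)(h)$ is smooth), and let $D:\mathcal G\to\mathcal H$ be a crossed homomorphism with respect to $\Phi$, that is, a smooth map with $D(gh)=D(g)\,\Phi(g)(D(h))$ for all $g,h\in\mathcal G$. Put $d=D_{*e}:\mathfrak g\to\mathfrak h$. For a smooth action $\Psi$ of $\mathcal G$ on $\mathcal H$ by automorphisms write $\Psi(g)_*:\mathfrak h\to\mathfrak h$ for the differential of $\Psi(g)$ at $e$, and $\Psi_*$ for the derivative at $e\in\mathcal G$ of the map $g\mapsto\Psi(g)_*\in\mathrm{End}(\mathfrak h)$. Let $$\Phi_D(g)=\mathrm{Ad}_{D(g)}\circ\Phi(g),\qquad \Phi_D(g)(h)=D(g)\,\Phi(g)(h)\,D(g)^{-1},\qquad \overline D(g)=D(g)^{-1}.$$ Then $g\mapsto\Phi(g)_*$ is differentiable at $e$ and $\phi:=\Phi_*$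 is a Lie algebra homomorphism $\mathfrak g\to\mathrm{Der}(\mathfrak h)$; the map $d$ is a crossed homomorphism of Lie algebras with respect to $\phi$, i.e. $d[x,y]=\phi(x)(d(y))-\phi(y)(d(x))+[d(x),d(y)]$; and $$\phi_d(x)(u)=\phi(x)(u)+[d(x),u]\qquad(x\in\mathfrak g,\ u\in\mathfrak h)$$ defines a Lie algebra homomorphism $\phi_d:\mathfrak g\to\mathrm{Der}(\mathfrak h)$. Moreover: 1. $\Phi_D$ is a smooth action of $\mathcal G$ on $\mathcal H$ by automorphisms, $g\mapsto\Phi_D(g)_*$ is differentiable at $e$, and $(\Phi_D)_*=\phi_d$. 2. $\overline D$ is smooth and a crossed homomorphism with respect to $\Phi_D$, its differential at $e$ is $\overline D_{*e}=-d$, and $-d$ is a crossed homomorphism of Lie algebras with respect to $\phi_d$. -/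

import Mathlib

open scoped Manifold ContDiff

noncomputable section

namespace CrossedHom

section Group

variable {G H : Type*} [Group G] [Group H]

/-- `D : G → H` is a crossed homomorphism with respect to the action `Φ` of `G` on `H` by group
automorphisms. -/
def IsCrossedHom (Φ : G →* MulAut H) (D : G → H) : Prop :=
  ∀ g h : G, D (g * h) = D g * Φ g (D h)

/-- The derived action `Φ_D(g) = Ad_{D(g)} ∘ Φ(g)`, that is,
`Φ_D(g)(h) = D(g) Φ(g)(h) D(g)⁻¹`. -/
def derivedAction (Φ : G →* MulAut H) (D : G → H) (hD : IsCrossedHom Φ D) : G →* MulAut H :=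
  MonoidHom.mk' (fun g => MulAut.conj (D g) * Φ g) (by
    intro a b
    ext h
    simp [hD a b, mul_assoc])

end Group

section Lie

variable {L M : Type*} [LieRing L] [LieAlgebra ℝ L] [LieRing M] [LieAlgebra ℝ M]

/-- A linear map `d : L → M` is a crossed homomorphism with respect to the action `φ` of the Lie
algebra `L` on the Lie algebra `M` by derivations. -/
def IsLieCrossedHom (φ : L →ₗ⁅ℝ⁆ LieDerivation ℝ M M) (d : L →ₗ[ℝ] M) : Prop :=
  ∀ x y : L, d ⁅x, y⁆ = φ x (d y) - φ y (d x) + ⁅d x, d y⁆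

/-- The derived action `φ_d(x)(u) = φ(x)(u) + [d(x), u]`. -/
def derivedLieAction (φ : L →ₗ⁅ℝ⁆ LieDerivation ℝ M M) (d : L →ₗ[ℝ] M)
    (hd : IsLieCrossedHom φ d) : L →ₗ⁅ℝ⁆ LieDerivation ℝ M M where
  toFun x := φ x + LieDerivation.ad ℝ M (d x)
  map_add' x y := by
    ext u
    simp
    abel
  map_smul' c x := by
    ext u
    simp
  map_lie' := by
    intro x y
    ext u
    have h1 : ⁅⁅d x, d y⁆, u⁆ = ⁅d x, ⁅d y, u⁆⁆ - ⁅d y, ⁅d x, u⁆⁆ := lie_lie _ _ _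
    have h2 : ⁅φ x (d y) - φ y (d x) + ⁅d x, d y⁆, u⁆
        = ⁅φ x (d y), u⁆ - ⁅φ y (d x), u⁆ + ⁅⁅d x, d y⁆, u⁆ := by
      rw [add_lie, sub_lie]
    have h3 : φ x ⁅d y, u⁆ = ⁅d y, φ x u⁆ + ⁅φ x (d y), u⁆ := by
      rw [LieDerivation.apply_lie_eq_add]
    have h4 : φ y ⁅d x, u⁆ = ⁅d x, φ y u⁆ + ⁅φ y (d x), u⁆ := by
      rw [LieDerivation.apply_lie_eq_add]
    have h5 : φ ⁅x, y⁆ u = φ x (φ y u) - φ y (φ x u) := by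
      rw [LieHom.map_lie, LieDerivation.lie_apply]
    rw [LieDerivation.lie_apply]
    simp only [LieDerivation.add_apply, LieDerivation.ad_apply_apply]
    rw [h5, hd x y, h2, h1, map_add, map_add, h3, h4, lie_add, lie_add]
    abel

end Lie

section LieGroup

variable {EG : Type*} [NormedAddCommGroup EG] [NormedSpace ℝ EG]
  {HG : Type*} [TopologicalSpace HG] (IG : ModelWithCorners ℝ EG HG)
  {EH : Type*} [NormedAddCommGroup EH] [NormedSpace ℝ EH]
  {HH : Type*} [TopologicalSpace HH] (IH : ModelWithCorners ℝ EH HH)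
  {G : Type*} [TopologicalSpace G] [ChartedSpace HG G] [Group G]
  {H : Type*} [TopologicalSpace H] [ChartedSpace HH H] [Group H]

/-- A smooth real Lie group has the regularity that Mathlib's Lie algebra structure on
`GroupLieAlgebra` asks for. -/
instance lieGroup_minSmoothness {E : Type*} [NormedAddCommGroup E] [NormedSpace ℝ E]
    {HE : Type*} [TopologicalSpace HE] (I : ModelWithCorners ℝ E HE)
    {K : Type*} [TopologicalSpace K] [ChartedSpace HE K] [Group K] [LieGroup I ∞ K] :
    LieGroup I (minSmoothness ℝ 3) K :=
  LieGroup.of_le (n := ∞) (by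
    rw [minSmoothness_of_isRCLikeNormedField]
    exact ENat.LEInfty.out)

/-- The differential `f_{*e} : 𝔤 → 𝔥` at the identity of a map `f : G → H` with `f(e) = e`; it is
used for such maps only. The target of `mfderiv` is the tangent space at `f 1`, which is the
tangent space at `1`. -/
def diffAtOne (f : G → H) : GroupLieAlgebra IG G →L[ℝ] GroupLieAlgebra IH H :=
  mfderiv IG IH f 1

/-- `Φ` is an action of the Lie group `G` on the Lie group `H`: the map `(g, h) ↦ Φ(g)(h)` is
smooth. -/
def IsSmoothAction (Φ : G →* MulAut H) : Prop :=
  ContMDiff (IG.prod IH) IH ∞ (fun p : G × H => Φ p.1 p.2)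

/-- The map `g ↦ Φ(g)_*`, where `Φ(g)_*` is the differential of `Φ(g) : H → H` at the identity,
with values in the endomorphisms of the tangent space `𝔥` (as a vector space, `𝔥` is `EH`, which
carries the norm). -/
def linearizedAction (Φ : G →* MulAut H) (g : G) : EH →L[ℝ] EH :=
  diffAtOne IH IH (Φ g)

/-- `φ : 𝔤 → Der(𝔥)` is the differential `Φ_*` of the action `Φ`: the map `g ↦ Φ(g)_* ∈ End(𝔥)`
is differentiable at the identity, and its derivative there is `φ`. -/
def IsActionDifferential [CompleteSpace EG] [CompleteSpace EH]
    [LieGroup IG ∞ G] [LieGroup IH ∞ H]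
    (Φ : G →* MulAut H)
    (φ : GroupLieAlgebra IG G →ₗ⁅ℝ⁆
      LieDerivation ℝ (GroupLieAlgebra IH H) (GroupLieAlgebra IH H)) : Prop :=
  MDifferentiableAt IG 𝓘(ℝ, EH →L[ℝ] EH) (linearizedAction IH Φ) 1 ∧
    ∀ (x : GroupLieAlgebra IG G) (u : GroupLieAlgebra IH H),
      φ x u = (show EH →L[ℝ] EH from mfderiv IG 𝓘(ℝ, EH →L[ℝ] EH) (linearizedAction IH Φ) 1 x) u

end LieGroup

end CrossedHom

end

/-!
Everything is computed in the preferred charts at the identities, where each statement about Lie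
algebras becomes a statement about mixed second derivatives `∂₁∂₂F` of maps of two variables
(`mixedDeriv`). If `m` is a group multiplication in a chart at the identity `a`, the left-invariant
field of `v` is `p ↦ ∂₂m(p, a) v`, so that `[v, w] = ∂₁∂₂m(v, w) - ∂₁∂₂m(w, v)`
(`bracket_eq_mixedDeriv`); and `Φ_*` is the mixed second derivative of `(g, h) ↦ Φ(g)(h)`
(`IsSmoothAction.hasMFDerivAt_linearizedAction`).

The analytic core is `fderiv_mixedDeriv_sub`: an identity `f(m(p, q)) = k(p, q)`, differentiated in
`q` and then in `p` and antisymmetrized, gives `Df [x, y] = ∂₁∂₂k(x, y) - ∂₁∂₂k(y, x)`, because the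
second derivative of `f` is symmetric. Applied to `D(gh) = D(g) Φ(g)(D(h))` it shows that `d` is a
crossed homomorphism; applied to `Φ(gh)_* = Φ(g)_* Φ(h)_*` it shows that `Φ_*` preserves brackets.
An automorphism of `H` is a crossed homomorphism for the trivial action, so `Φ(g)_*` preserves the
bracket of `𝔥`, and differentiating this in `g` shows that `Φ_*` takes values in derivations.

The formula for the differential of `Φ_D` comes from comparing the mixed second derivatives of the
two sides of `Φ_D(g)(h) D(g) = D(g) Φ(g)(h)`: the left side contributes `∂₁∂₂m(u, d x)`, the right
side `∂₁∂₂m(d x, u)`, and their difference is `[d x, u]`.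
-/

/-! ### Mixed second derivatives in normed spaces -/

namespace CrossedHom

open Filter Topology

section Calculus

variable {E E₁ E₂ E₃ E₄ E₅ : Type*} [NormedAddCommGroup E] [NormedSpace ℝ E]
  [NormedAddCommGroup E₁] [NormedSpace ℝ E₁] [NormedAddCommGroup E₂] [NormedSpace ℝ E₂]
  [NormedAddCommGroup E₃] [NormedSpace ℝ E₃] [NormedAddCommGroup E₄] [NormedSpace ℝ E₄]
  [NormedAddCommGroup E₅] [NormedSpace ℝ E₅]

/-- The mixed second derivative `∂₁∂₂F(a, b)`, as a bilinear map `(x, u) ↦ ∂₁∂₂F(a, b)(x, u)`, with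
`x` the direction in the first variable. -/
noncomputable def mixedDeriv (F : E₁ → E₂ → E₃) (a : E₁) (b : E₂) : E₁ →L[ℝ] E₂ →L[ℝ] E₃ :=
  fderiv ℝ (fun p => fderiv ℝ (F p) b) a

theorem mixedDeriv_congr {F F' : E₁ → E₂ → E₃} {a : E₁} {b : E₂}
    (h : ∀ᶠ z in 𝓝 (a, b), F z.1 z.2 = F' z.1 z.2) : mixedDeriv F a b = mixedDeriv F' a b := by
  rw [nhds_prod_eq] at h
  have e : (fun p => fderiv ℝ (F p) b) =ᶠ[𝓝 a] fun p => fderiv ℝ (F' p) b :=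
    h.curry.mono fun p hp => EventuallyEq.fderiv_eq hp
  rw [mixedDeriv, e.fderiv_eq, mixedDeriv]

theorem differentiableAt_partialFDeriv {F : E₁ → E₂ → E₃} {a : E₁} {b : E₂}
    (hF : ContDiffAt ℝ 2 (Function.uncurry F) (a, b)) :
    DifferentiableAt ℝ (fun p => fderiv ℝ (F p) b) a :=
  (hF.fderiv (m := 1) (g := fun _ => b) contDiffAt_const (by norm_num)).differentiableAt
    (by norm_num)

theorem hasFDerivAt_mixedDeriv {F : E₁ → E₂ → E₃} {a : E₁} {b : E₂}
    (hF : ContDiffAt ℝ 2 (Function.uncurry F) (a, b)) :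
    HasFDerivAt (fun p => fderiv ℝ (F p) b) (mixedDeriv F a b) a :=
  (differentiableAt_partialFDeriv hF).hasFDerivAt

theorem contDiffAt_swap {F : E₁ → E₂ → E₃} {a : E₁} {b : E₂} {n : ℕ∞ω}
    (hF : ContDiffAt ℝ n (Function.uncurry F) (a, b)) :
    ContDiffAt ℝ n (Function.uncurry fun q p => F p q) (b, a) :=
  ContDiffAt.comp (f := fun z : E₂ × E₁ => (z.2, z.1)) (b, a) hF
    (contDiffAt_snd.prodMk contDiffAt_fst)

theorem eventually_differentiableAt {f : E₁ → E₂} {a : E₁} (hf : ContDiffAt ℝ 2 f a) :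
    ∀ᶠ p in 𝓝 a, DifferentiableAt ℝ f p :=
  (hf.eventually (by simp)).mono fun _ h => h.differentiableAt (by norm_num)

theorem eventually_differentiableAt_right {F : E₁ → E₂ → E₃} {a : E₁} {b : E₂}
    (hF : ContDiffAt ℝ 2 (Function.uncurry F) (a, b)) :
    ∀ᶠ p in 𝓝 a, DifferentiableAt ℝ (F p) b := by
  have hc : Tendsto (fun p : E₁ => (p, b)) (𝓝 a) (𝓝 (a, b)) :=
    (Continuous.prodMk_left b).tendsto a
  filter_upwards [hc.eventually (eventually_differentiableAt hF)] with p hp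
  exact DifferentiableAt.comp (g := Function.uncurry F) b hp
    ((differentiableAt_const p).prodMk differentiableAt_id)

theorem mixedDeriv_swap_apply {F : E₁ → E₂ → E₃} {a : E₁} {b : E₂}
    (hF : ContDiffAt ℝ 2 (Function.uncurry F) (a, b)) (x : E₁) (u : E₂) :
    mixedDeriv (fun q p => F p q) b a u x = mixedDeriv F a b x u := by
  -- Both sides are values of the second derivative of the uncurried map.
  have h2 : DifferentiableAt ℝ (fderiv ℝ (Function.uncurry F)) (a, b) :=
    (hF.fderiv_right (m := 1) (by norm_num)).differentiableAt (by norm_num)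
  have hev := eventually_differentiableAt hF
  have left : mixedDeriv F a b x u
      = fderiv ℝ (fderiv ℝ (Function.uncurry F)) (a, b) (x, 0) (0, u) := by
    have hc : Tendsto (fun p : E₁ => (p, b)) (𝓝 a) (𝓝 (a, b)) :=
      (Continuous.prodMk_left b).tendsto a
    have e : (fun p => fderiv ℝ (F p) b) =ᶠ[𝓝 a]
        fun p => (fderiv ℝ (Function.uncurry F) (p, b)).comp (ContinuousLinearMap.inr ℝ E₁ E₂) := by
      filter_upwards [hc.eventually hev] with p hp
      exact (hp.hasFDerivAt.comp b (hasFDerivAt_prodMk_right p b)).fderiv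
    have hd := (h2.hasFDerivAt.comp (f := fun p : E₁ => (p, b)) a
      (hasFDerivAt_prodMk_left a b)).clm_comp
      (hasFDerivAt_const (ContinuousLinearMap.inr ℝ E₁ E₂) a)
    simp only [Function.comp_apply] at hd
    rw [mixedDeriv, e.fderiv_eq, hd.fderiv]
    simp
  have right : mixedDeriv (fun q p => F p q) b a u x
      = fderiv ℝ (fderiv ℝ (Function.uncurry F)) (a, b) (0, u) (x, 0) := by
    have hc : Tendsto (fun q : E₂ => (a, q)) (𝓝 b) (𝓝 (a, b)) :=
      (Continuous.prodMk_right a).tendsto b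
    have e : (fun q => fderiv ℝ (fun p => F p q) a) =ᶠ[𝓝 b]
        fun q => (fderiv ℝ (Function.uncurry F) (a, q)).comp (ContinuousLinearMap.inl ℝ E₁ E₂) := by
      filter_upwards [hc.eventually hev] with q hq
      exact (hq.hasFDerivAt.comp (f := fun p : E₁ => (p, q)) a (hasFDerivAt_prodMk_left a q)).fderiv
    have hd := (h2.hasFDerivAt.comp (f := fun q : E₂ => (a, q)) b
      (hasFDerivAt_prodMk_right a b)).clm_comp
      (hasFDerivAt_const (ContinuousLinearMap.inl ℝ E₁ E₂) b)
    simp only [Function.comp_apply] at hd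
    rw [mixedDeriv, e.fderiv_eq, hd.fderiv]
    simp
  rw [left, right]
  exact (hF.isSymmSndFDerivAt (by simp)).eq _ _

/-- Differentiating `f(m(p, q)) = k(p, q)` in `q` and then in `p` at a two-sided unit `a` of `m`
gives `D²f(x, y) + Df(∂₁∂₂m(x, y)) = ∂₁∂₂k(x, y)`; antisymmetrizing removes the second derivative
of `f`. -/
theorem fderiv_mixedDeriv_sub {f : E → E₁} {m : E → E → E} {k : E → E → E₁} {a : E}
    (hf : ContDiffAt ℝ 2 f a) (hm : ContDiffAt ℝ 2 (Function.uncurry m) (a, a))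
    (m_right : ∀ᶠ p in 𝓝 a, m p a = p) (m_left : ∀ᶠ q in 𝓝 a, m a q = q)
    (h : ∀ᶠ z in 𝓝 (a, a), f (m z.1 z.2) = k z.1 z.2) (x y : E) :
    fderiv ℝ f a (mixedDeriv m a a x y - mixedDeriv m a a y x)
      = mixedDeriv k a a x y - mixedDeriv k a a y x := by
  have hfst : ∀ᶠ p in 𝓝 a,
      (fderiv ℝ f p).comp (fderiv ℝ (m p) a) = fderiv ℝ (k p) a := by
    rw [nhds_prod_eq] at h
    filter_upwards [h.curry, m_right, eventually_differentiableAt hf,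
      eventually_differentiableAt_right hm] with p hp hpa hfp hmp
    have e : (fun q => f (m p q)) =ᶠ[𝓝 a] k p := hp
    rw [← e.fderiv_eq, fderiv_fun_comp a (by rwa [hpa]) hmp, hpa]
  have hid : fderiv ℝ (m a) a = ContinuousLinearMap.id ℝ E := by
    have e : m a =ᶠ[𝓝 a] id := m_left
    rw [e.fderiv_eq, fderiv_id]
  have h2 : HasFDerivAt (fderiv ℝ f) (fderiv ℝ (fderiv ℝ f) a) a :=
    ((hf.fderiv_right (m := 1) (by norm_num)).differentiableAt (by norm_num)).hasFDerivAt
  have hsnd : ∀ x y, mixedDeriv k a a x y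
      = fderiv ℝ f a (mixedDeriv m a a x y) + fderiv ℝ (fderiv ℝ f) a x y := by
    intro x y
    have hd := h2.clm_comp (hasFDerivAt_mixedDeriv hm)
    have e : (fun p => fderiv ℝ (k p) a) =ᶠ[𝓝 a]
        fun p => (fderiv ℝ f p).comp (fderiv ℝ (m p) a) := hfst.mono fun _ h => h.symm
    rw [mixedDeriv, e.fderiv_eq, hd.fderiv]
    simp [hid]
  rw [hsnd, hsnd, (hf.isSymmSndFDerivAt (by simp)).eq x y, map_sub]
  abel

/-- The mixed second derivative of `(p, q) ↦ n(δ(p), F(p, ε(q)))` at a point where `F(·, b)` is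
constant. -/
theorem mixedDeriv_comp_apply {δ : E → E₂} {F : E → E₁ → E₃} {ε : E₅ → E₁} {n : E₂ → E₃ → E₄}
    {a : E} {e : E₅} {b : E₁} {c : E₃} (hεe : ε e = b) (hFb : ∀ᶠ p in 𝓝 a, F p b = c)
    (hδ : DifferentiableAt ℝ δ a) (hε : DifferentiableAt ℝ ε e)
    (hF : ContDiffAt ℝ 2 (Function.uncurry F) (a, b))
    (hn : ContDiffAt ℝ 2 (Function.uncurry n) (δ a, c)) (x : E) (y : E₅) :
    mixedDeriv (fun p q => n (δ p) (F p (ε q))) a e x y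
      = mixedDeriv n (δ a) c (fderiv ℝ δ a x) (fderiv ℝ (F a) b (fderiv ℝ ε e y))
        + fderiv ℝ (n (δ a)) c (mixedDeriv F a b x (fderiv ℝ ε e y)) := by
  have heq : (fun p => fderiv ℝ (fun q => n (δ p) (F p (ε q))) e) =ᶠ[𝓝 a]
      fun p => ((fderiv ℝ (n (δ p)) c).comp (fderiv ℝ (F p) b)).comp (fderiv ℝ ε e) := by
    filter_upwards [hFb, eventually_differentiableAt_right hF,
      hδ.continuousAt.eventually (eventually_differentiableAt_right hn)] with p hpb hFp hnp
    subst hεe hpb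
    exact (hnp.hasFDerivAt.comp e (hFp.hasFDerivAt.comp e hε.hasFDerivAt)).fderiv
  have hd := (((hasFDerivAt_mixedDeriv hn).comp a hδ.hasFDerivAt).clm_comp
    (hasFDerivAt_mixedDeriv hF)).clm_comp (hasFDerivAt_const (fderiv ℝ ε e) a)
  simp only [Function.comp_apply] at hd
  rw [mixedDeriv, heq.fderiv_eq, hd.fderiv]
  simp [add_comm]

end Calculus

end CrossedHom

/-! ### Chart coordinates at the identity -/

namespace CrossedHom

open Filter Topology VectorField

section Coordinates

variable {E₁ : Type*} [NormedAddCommGroup E₁] [NormedSpace ℝ E₁]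
  {H₁ : Type*} [TopologicalSpace H₁] (I₁ : ModelWithCorners ℝ E₁ H₁)
  {E₂ : Type*} [NormedAddCommGroup E₂] [NormedSpace ℝ E₂]
  {H₂ : Type*} [TopologicalSpace H₂] (I₂ : ModelWithCorners ℝ E₂ H₂)
  {E₃ : Type*} [NormedAddCommGroup E₃] [NormedSpace ℝ E₃]
  {H₃ : Type*} [TopologicalSpace H₃] (I₃ : ModelWithCorners ℝ E₃ H₃)
  {G₁ : Type*} [TopologicalSpace G₁] [ChartedSpace H₁ G₁] [Group G₁]
  {G₂ : Type*} [TopologicalSpace G₂] [ChartedSpace H₂ G₂] [Group G₂]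
  {G₃ : Type*} [TopologicalSpace G₃] [ChartedSpace H₃ G₃] [Group G₃]

/-- A map between groups, read in the preferred charts at the two identities. It is defined on the
whole model space, and represents the map only near the image of the identity. -/
noncomputable def coordRep (f : G₁ → G₂) : E₁ → E₂ := fun p =>
  extChartAt I₂ (1 : G₂) (f ((extChartAt I₁ (1 : G₁)).symm p))

/-- A map of two group variables, read in the preferred charts at the three identities; as for
`coordRep`, only its germ at the images of the identities matters. -/
noncomputable def coordRep₂ (f : G₁ → G₂ → G₃) : E₁ → E₂ → E₃ := fun p q =>
  extChartAt I₃ (1 : G₃) (f ((extChartAt I₁ (1 : G₁)).symm p) ((extChartAt I₂ (1 : G₂)).symm q))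

variable (G₁) in
theorem tendsto_extChartAt_symm_one :
    Tendsto (extChartAt I₁ (1 : G₁)).symm (𝓝 (extChartAt I₁ (1 : G₁) 1)) (𝓝 1) := by
  simpa [ContinuousAt] using continuousAt_extChartAt_symm (I := I₁) (1 : G₁)

variable (G₁) in
theorem eventually_extChartAt_symm_left_inv :
    ∀ᶠ g in 𝓝 (1 : G₁), (extChartAt I₁ (1 : G₁)).symm (extChartAt I₁ (1 : G₁) g) = g :=
  Filter.mem_of_superset (extChartAt_source_mem_nhds (I := I₁) (1 : G₁))
    fun _ h => PartialEquiv.left_inv _ h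

variable (G₁) in
theorem eventually_extChartAt_symm_right_inv [I₁.Boundaryless] :
    ∀ᶠ p in 𝓝 (extChartAt I₁ (1 : G₁) 1),
      extChartAt I₁ (1 : G₁) ((extChartAt I₁ (1 : G₁)).symm p) = p := by
  filter_upwards [extChartAt_target_mem_nhds (I := I₁) (1 : G₁)] with p hp
  exact PartialEquiv.right_inv _ hp

theorem coordRep_extChartAt_one {f : G₁ → G₂} (hf : f 1 = 1) :
    coordRep I₁ I₂ f (extChartAt I₁ (1 : G₁) 1) = extChartAt I₂ (1 : G₂) 1 := by
  rw [coordRep, extChartAt_to_inv, hf]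

variable [I₁.Boundaryless] [I₂.Boundaryless]

variable {n : ℕ∞ω}

variable (G₁) in
theorem contMDiffAt_extChartAt_symm_one [IsManifold I₁ n G₁] :
    ContMDiffAt 𝓘(ℝ, E₁) I₁ n (extChartAt I₁ (1 : G₁)).symm (extChartAt I₁ (1 : G₁) 1) :=
  (contMDiffOn_extChartAt_symm (1 : G₁)).contMDiffAt (extChartAt_target_mem_nhds _)

omit [I₂.Boundaryless] in
theorem contDiffAt_coordRep [IsManifold I₁ n G₁] [IsManifold I₂ n G₂] {f : G₁ → G₂}
    (hf : ContMDiffAt I₁ I₂ n f 1) (h1 : f 1 = 1) :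
    ContDiffAt ℝ n (coordRep I₁ I₂ f) (extChartAt I₁ (1 : G₁) 1) := by
  rw [← contMDiffAt_iff_contDiffAt]
  refine ContMDiffAt.comp_of_eq (I' := I₂) (y := 1) contMDiffAt_extChartAt ?_ (by simp [h1])
  exact ContMDiffAt.comp_of_eq (I' := I₁) (y := 1) hf (contMDiffAt_extChartAt_symm_one I₁ G₁)
    (by simp)

theorem contDiffAt_coordRep₂ [IsManifold I₁ n G₁] [IsManifold I₂ n G₂] [IsManifold I₃ n G₃]
    {f : G₁ → G₂ → G₃}
    (hf : ContMDiffAt (I₁.prod I₂) I₃ n (Function.uncurry f) (1, 1)) (h1 : f 1 1 = 1) :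
    ContDiffAt ℝ n (Function.uncurry (coordRep₂ I₁ I₂ I₃ f))
      (extChartAt I₁ (1 : G₁) 1, extChartAt I₂ (1 : G₂) 1) := by
  rw [← contMDiffAt_iff_contDiffAt]
  refine ContMDiffAt.comp_of_eq (I' := I₃) (y := 1) contMDiffAt_extChartAt ?_ (by simp [h1])
  refine ContMDiffAt.comp_of_eq (I' := I₁.prod I₂) (y := ((1, 1) : G₁ × G₂))
    (g := Function.uncurry f) (f := fun z : E₁ × E₂ =>
      ((extChartAt I₁ (1 : G₁)).symm z.1, (extChartAt I₂ (1 : G₂)).symm z.2)) hf ?_ (by simp)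
  refine ContMDiffAt.prodMk ?_ ?_
  · exact ContMDiffAt.comp_of_eq (contMDiffAt_extChartAt_symm_one I₁ G₁)
      contDiff_fst.contMDiff.contMDiffAt rfl
  · exact ContMDiffAt.comp_of_eq (contMDiffAt_extChartAt_symm_one I₂ G₂)
      contDiff_snd.contMDiff.contMDiffAt rfl

variable (G₁) in
theorem contDiffAt_coordRep₂_mul [LieGroup I₁ ∞ G₁] :
    ContDiffAt ℝ ∞ (Function.uncurry (coordRep₂ I₁ I₁ I₁ fun g h : G₁ => g * h))
      (extChartAt I₁ (1 : G₁) 1, extChartAt I₁ (1 : G₁) 1) :=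
  contDiffAt_coordRep₂ I₁ I₁ I₁ (contMDiff_mul I₁ ∞).contMDiffAt (by simp)

omit [I₁.Boundaryless] in
theorem coordRep₂_one_left_eventuallyEq {f : G₁ → G₂ → G₂} (hf : ∀ h, f 1 h = h) :
    coordRep₂ I₁ I₂ I₂ f (extChartAt I₁ (1 : G₁) 1) =ᶠ[𝓝 (extChartAt I₂ (1 : G₂) 1)] id := by
  filter_upwards [eventually_extChartAt_symm_right_inv I₂ G₂] with q hq
  simp only [coordRep₂, extChartAt_to_inv, hf, hq, id]

omit [I₁.Boundaryless] in
theorem fderiv_coordRep₂_of_one_left {f : G₁ → G₂ → G₂} (hf : ∀ h, f 1 h = h) :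
    fderiv ℝ (coordRep₂ I₁ I₂ I₂ f (extChartAt I₁ (1 : G₁) 1)) (extChartAt I₂ (1 : G₂) 1)
      = ContinuousLinearMap.id ℝ E₂ := by
  rw [(coordRep₂_one_left_eventuallyEq I₁ I₂ hf).fderiv_eq, fderiv_id]

omit [I₂.Boundaryless] in
theorem diffAtOne_eq_fderiv {f : G₁ → G₂} (hf : MDifferentiableAt I₁ I₂ f 1) (h1 : f 1 = 1) :
    diffAtOne I₁ I₂ f = fderiv ℝ (coordRep I₁ I₂ f) (extChartAt I₁ (1 : G₁) 1) := by
  have e : (writtenInExtChartAt I₁ I₂ 1 f : E₁ → E₂) = coordRep I₁ I₂ f := by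
    funext p
    simp [writtenInExtChartAt, coordRep, h1]
  rw [diffAtOne, hf.mfderiv, I₁.range_eq_univ, fderivWithin_univ, e]

/-- The bracket of the Lie algebra of a Lie group is the antisymmetrization of the mixed second
derivative of the multiplication in a chart: the left-invariant field of `v` is `p ↦ ∂₂m(p, a) v`
in the chart. -/
theorem bracket_eq_mixedDeriv [LieGroup I₁ ∞ G₁] (v w : GroupLieAlgebra I₁ G₁) :
    ⁅v, w⁆ = mixedDeriv (coordRep₂ I₁ I₁ I₁ fun g h : G₁ => g * h)
        (extChartAt I₁ (1 : G₁) 1) (extChartAt I₁ (1 : G₁) 1) v w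
      - mixedDeriv (coordRep₂ I₁ I₁ I₁ fun g h : G₁ => g * h)
        (extChartAt I₁ (1 : G₁) 1) (extChartAt I₁ (1 : G₁) 1) w v := by
  set a := extChartAt I₁ (1 : G₁) 1 with ha
  set m := coordRep₂ I₁ I₁ I₁ fun g h : G₁ => g * h with hm
  have hm2 : ContDiffAt ℝ 2 (Function.uncurry m) (a, a) :=
    (contDiffAt_coordRep₂_mul I₁ G₁).of_le ENat.LEInfty.out
  have hfield : ∀ v : GroupLieAlgebra I₁ G₁,
      (mpullbackWithin 𝓘(ℝ, E₁) I₁ (extChartAt I₁ (1 : G₁)).symm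
        (mulInvariantVectorField v) Set.univ : E₁ → E₁) =ᶠ[𝓝 a]
      fun p => fderiv ℝ (m p) a v := by
    intro v
    filter_upwards [extChartAt_target_mem_nhds (I := I₁) (1 : G₁)] with p hp
    set g := (extChartAt I₁ (1 : G₁)).symm p with hg
    have hgs : g ∈ (chartAt H₁ (1 : G₁)).source := by
      rw [← extChartAt_source (I := I₁)]
      exact (extChartAt I₁ (1 : G₁)).map_target hp
    have hκ : MDifferentiableAt I₁ 𝓘(ℝ, E₁) (extChartAt I₁ (1 : G₁)) (g * 1) := by
      rw [mul_one]
      exact mdifferentiableAt_extChartAt hgs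
    have hL : MDifferentiableAt I₁ I₁ (fun h : G₁ => g * h) 1 :=
      (contMDiff_mul_left (I := I₁) (n := 1) (a := g)).mdifferentiableAt (by simp)
    have h1 : (mfderivWithin 𝓘(ℝ, E₁) I₁ (extChartAt I₁ (1 : G₁)).symm (Set.range I₁) p).inverse
        = mfderiv I₁ 𝓘(ℝ, E₁) (extChartAt I₁ (1 : G₁)) g :=
      ContinuousLinearMap.inverse_eq (mfderivWithin_extChartAt_symm_comp_mfderiv_extChartAt hp)
        (mfderiv_extChartAt_comp_mfderivWithin_extChartAt_symm hp)
    have h2 := mfderiv_comp (1 : G₁) hκ hL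
    have h3 : mfderiv I₁ 𝓘(ℝ, E₁) (extChartAt I₁ (1 : G₁) ∘ fun h : G₁ => g * h) 1
        = fderiv ℝ (m p) a := by
      rw [(hκ.comp (1 : G₁) hL).mfderiv, I₁.range_eq_univ, fderivWithin_univ]
      rfl
    have h4 : mfderiv I₁ 𝓘(ℝ, E₁) (extChartAt I₁ (1 : G₁)) (g * 1)
        = (mfderiv I₁ 𝓘(ℝ, E₁) (extChartAt I₁ (1 : G₁)) g : E₁ →L[ℝ] E₁) := by
      rw [mul_one]
    -- In the chart, the left-invariant field of `v` is the derivative at `1` of `g * ·` followed by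
    -- the chart.
    rw [I₁.range_eq_univ] at h1
    calc _ = mfderiv I₁ 𝓘(ℝ, E₁) (extChartAt I₁ (1 : G₁)) g
          (mfderiv I₁ I₁ (fun h : G₁ => g * h) 1 v) :=
        congrArg (fun A : E₁ →L[ℝ] E₁ => A (mfderiv I₁ I₁ (fun h : G₁ => g * h) 1 v)) h1
      _ = _ := ?_
    rw [← h3, h2]
    exact (congrArg (fun A : E₁ →L[ℝ] E₁ => A _) h4).symm
  have hid : fderiv ℝ (m a) a = ContinuousLinearMap.id ℝ E₁ :=
    fderiv_coordRep₂_of_one_left I₁ I₁ one_mul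
  have hderiv : ∀ v w : E₁, fderiv ℝ (fun p => fderiv ℝ (m p) a v) a w = mixedDeriv m a a w v := by
    intro v w
    have h := (hasFDerivAt_mixedDeriv hm2).clm_apply (hasFDerivAt_const v a)
    rw [h.fderiv]
    simp
  have hlie : ∀ v w : E₁, lieBracket ℝ (fun p => fderiv ℝ (m p) a v)
      (fun p => fderiv ℝ (m p) a w) a = mixedDeriv m a a v w - mixedDeriv m a a w v := by
    intro v w
    rw [lieBracket_eq]
    dsimp only
    rw [hderiv, hderiv, hid]
    rfl
  have hbr : lieBracketWithin ℝ
      (mpullbackWithin 𝓘(ℝ, E₁) I₁ (extChartAt I₁ (1 : G₁)).symm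
        (mulInvariantVectorField v) (Set.range I₁))
      (mpullbackWithin 𝓘(ℝ, E₁) I₁ (extChartAt I₁ (1 : G₁)).symm
        (mulInvariantVectorField w) (Set.range I₁))
      ((extChartAt I₁ (1 : G₁)).symm ⁻¹' Set.univ ∩ Set.range I₁) a
      = mixedDeriv m a a v w - mixedDeriv m a a w v := by
    simp only [I₁.range_eq_univ, Set.preimage_univ, Set.inter_univ]
    refine (congrFun lieBracketWithin_univ a).trans ?_
    exact (Filter.EventuallyEq.lieBracket_vectorField_eq (hfield v) (hfield w)).trans (hlie v w)
  have hinv : (mfderiv I₁ 𝓘(ℝ, E₁) (extChartAt I₁ (1 : G₁)) 1).inverse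
      = ContinuousLinearMap.id ℝ E₁ := by
    rw [mfderiv_extChartAt_self]
    exact ContinuousLinearMap.inverse_id
  exact (congrArg (fun A : E₁ →L[ℝ] E₁ => A _) hinv).trans hbr

end Coordinates

section Linearized

variable {EG : Type*} [NormedAddCommGroup EG] [NormedSpace ℝ EG]
  {HG : Type*} [TopologicalSpace HG] (IG : ModelWithCorners ℝ EG HG) [IG.Boundaryless]
  {EH : Type*} [NormedAddCommGroup EH] [NormedSpace ℝ EH]
  {HH : Type*} [TopologicalSpace HH] (IH : ModelWithCorners ℝ EH HH) [IH.Boundaryless]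
  {G : Type*} [TopologicalSpace G] [ChartedSpace HG G] [Group G] [LieGroup IG ∞ G]
  {H : Type*} [TopologicalSpace H] [ChartedSpace HH H] [Group H] [LieGroup IH ∞ H]
  {Φ : G →* MulAut H}

omit [IG.Boundaryless] [IH.Boundaryless] [LieGroup IG ∞ G] [LieGroup IH ∞ H] in
theorem IsSmoothAction.contMDiff_apply (hΦ : IsSmoothAction IG IH Φ) (g : G) :
    ContMDiff IH IH ∞ (Φ g) :=
  hΦ.comp (contMDiff_const.prodMk contMDiff_id)

theorem IsSmoothAction.contDiffAt_coordRep₂ (hΦ : IsSmoothAction IG IH Φ) :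
    ContDiffAt ℝ ∞ (Function.uncurry (coordRep₂ IG IH IH fun g h => Φ g h))
      (extChartAt IG (1 : G) 1, extChartAt IH (1 : H) 1) :=
  CrossedHom.contDiffAt_coordRep₂ IG IH IH hΦ.contMDiffAt (by simp)

omit [IG.Boundaryless] [LieGroup IG ∞ G] [LieGroup IH ∞ H] in
theorem IsSmoothAction.linearizedAction_eq_fderiv (hΦ : IsSmoothAction IG IH Φ) (g : G) :
    linearizedAction IH Φ g = fderiv ℝ (coordRep IH IH (Φ g)) (extChartAt IH (1 : H) 1) :=
  diffAtOne_eq_fderiv IH IH ((hΦ.contMDiff_apply IG IH g).mdifferentiable (by simp) 1) (map_one _)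

/-- The differential at the identity of `g ↦ Φ(g)_*` is the mixed second derivative of the action
in charts. -/
theorem IsSmoothAction.hasMFDerivAt_linearizedAction (hΦ : IsSmoothAction IG IH Φ) :
    HasMFDerivAt IG 𝓘(ℝ, EH →L[ℝ] EH) (linearizedAction IH Φ) 1
      (mixedDeriv (coordRep₂ IG IH IH fun g h => Φ g h)
        (extChartAt IG (1 : G) 1) (extChartAt IH (1 : H) 1) :) := by
  have h1 := (hasFDerivAt_mixedDeriv ((hΦ.contDiffAt_coordRep₂ IG IH).of_le
    ENat.LEInfty.out)).hasMFDerivAt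
  have h2 : HasMFDerivAt IG 𝓘(ℝ, EG) (extChartAt IG (1 : G)) 1 (ContinuousLinearMap.id ℝ EG) := by
    have := (mdifferentiableAt_extChartAt (I := IG) (mem_chart_source HG (1 : G))).hasMFDerivAt
    rwa [mfderiv_extChartAt_self] at this
  refine (h1.comp (1 : G) h2).congr_of_eventuallyEq ?_
  filter_upwards [eventually_extChartAt_symm_left_inv IG G] with g hg
  rw [hΦ.linearizedAction_eq_fderiv IG IH g]
  change _ = fderiv ℝ (coordRep IH IH
    (Φ ((extChartAt IG (1 : G)).symm (extChartAt IG (1 : G) g)))) _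
  rw [hg]

end Linearized

end CrossedHom

/-! ### Crossed homomorphisms and their differentials -/

namespace CrossedHom

open Filter Topology

section Algebra

variable {G H : Type*} [Group G] [Group H] {Φ : G →* MulAut H} {D : G → H}

theorem IsCrossedHom.map_one (hD : IsCrossedHom Φ D) : D 1 = 1 := by
  simpa using hD 1 1

theorem derivedAction_apply (hD : IsCrossedHom Φ D) (g : G) (h : H) :
    derivedAction Φ D hD g h = D g * Φ g h * (D g)⁻¹ := rfl

theorem IsCrossedHom.inv (hD : IsCrossedHom Φ D) :
    IsCrossedHom (derivedAction Φ D hD) fun g => (D g)⁻¹ := by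
  intro g h
  simp [derivedAction_apply, hD g h, mul_assoc]

theorem derivedLieAction_apply {L M : Type*} [LieRing L] [LieAlgebra ℝ L] [LieRing M]
    [LieAlgebra ℝ M] {φ : L →ₗ⁅ℝ⁆ LieDerivation ℝ M M} {d : L →ₗ[ℝ] M} (hd : IsLieCrossedHom φ d)
    (x : L) (u : M) : derivedLieAction φ d hd x u = φ x u + ⁅d x, u⁆ := by
  change (φ x + LieDerivation.ad ℝ M (d x)) u = _
  simp

theorem IsLieCrossedHom.neg {L M : Type*} [LieRing L] [LieAlgebra ℝ L] [LieRing M]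
    [LieAlgebra ℝ M] {φ : L →ₗ⁅ℝ⁆ LieDerivation ℝ M M} {d : L →ₗ[ℝ] M}
    (hd : IsLieCrossedHom φ d) : IsLieCrossedHom (derivedLieAction φ d hd) (-d) := by
  intro x y
  simp only [derivedLieAction_apply, LinearMap.neg_apply, hd x y, map_neg, neg_lie, lie_neg,
    neg_neg]
  rw [← lie_skew (d x) (d y)]
  abel

end Algebra

section Differential

variable {EG : Type*} [NormedAddCommGroup EG] [NormedSpace ℝ EG]
  {HG : Type*} [TopologicalSpace HG] (IG : ModelWithCorners ℝ EG HG) [IG.Boundaryless]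
  {EH : Type*} [NormedAddCommGroup EH] [NormedSpace ℝ EH]
  {HH : Type*} [TopologicalSpace HH] (IH : ModelWithCorners ℝ EH HH) [IH.Boundaryless]
  {G : Type*} [TopologicalSpace G] [ChartedSpace HG G] [Group G] [LieGroup IG ∞ G]
  {H : Type*} [TopologicalSpace H] [ChartedSpace HH H] [Group H] [LieGroup IH ∞ H]
  {Φ : G →* MulAut H} {D : G → H}

/-- The differential `Φ_*` of an action, as the mixed second derivative of `(g, h) ↦ Φ(g)(h)` in
charts. -/
noncomputable def actionDeriv (Φ : G →* MulAut H) :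
    GroupLieAlgebra IG G →L[ℝ] GroupLieAlgebra IH H →L[ℝ] GroupLieAlgebra IH H :=
  (mixedDeriv (coordRep₂ IG IH IH fun g h => Φ g h)
    (extChartAt IG (1 : G) 1) (extChartAt IH (1 : H) 1) :)

omit [LieGroup IG ∞ G] [LieGroup IH ∞ H] [IG.Boundaryless] [IH.Boundaryless] in
theorem actionDeriv_one (x : GroupLieAlgebra IG G) (u : GroupLieAlgebra IH H) :
    actionDeriv IG IH (1 : G →* MulAut H) x u = 0 := by
  have h : (fun p : EG => fderiv ℝ (coordRep₂ IG IH IH (fun (g : G) (h : H) =>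
      (1 : G →* MulAut H) g h) p) (extChartAt IH (1 : H) 1))
      = fun _ => fderiv ℝ (coordRep IH IH (id : H → H)) (extChartAt IH (1 : H) 1) := rfl
  have h0 : mixedDeriv (coordRep₂ IG IH IH (fun (g : G) (h : H) => (1 : G →* MulAut H) g h))
      (extChartAt IG (1 : G) 1) (extChartAt IH (1 : H) 1) = 0 := by
    rw [mixedDeriv, h]
    exact fderiv_const_apply _
  exact congrArg (fun A : EG →L[ℝ] EH →L[ℝ] EH => A x u) h0

omit [IG.Boundaryless] in
theorem tendsto_coord_mul :
    Tendsto (fun z : EG × EG => (extChartAt IG (1 : G)).symm z.1 * (extChartAt IG (1 : G)).symm z.2)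
      (𝓝 (extChartAt IG (1 : G) 1, extChartAt IG (1 : G) 1)) (𝓝 1) := by
  have h := ((contMDiff_mul IG ∞ (G := G)).continuous.tendsto (1, 1)).comp
    (((tendsto_extChartAt_symm_one IG G).comp tendsto_fst).prodMk_nhds
      ((tendsto_extChartAt_symm_one IG G).comp tendsto_snd))
  rw [nhds_prod_eq]
  simpa [Function.comp_def] using h

/-- The differential of a crossed homomorphism is a crossed homomorphism: differentiate
`D(gh) = D(g) Φ(g)(D(h))` in `h`, then in `g`, and antisymmetrize. -/
theorem IsCrossedHom.diffAtOne_lie (hD : IsCrossedHom Φ D) (hΦ : IsSmoothAction IG IH Φ)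
    (hDs : ContMDiff IG IH ∞ D) (x y : GroupLieAlgebra IG G) :
    diffAtOne IG IH D ⁅x, y⁆ = actionDeriv IG IH Φ x (diffAtOne IG IH D y)
      - actionDeriv IG IH Φ y (diffAtOne IG IH D x)
      + ⁅diffAtOne IG IH D x, diffAtOne IG IH D y⁆ := by
  set a := extChartAt IG (1 : G) 1 with ha
  set b := extChartAt IH (1 : H) 1 with hb
  set mG := coordRep₂ IG IG IG fun g h : G => g * h with hmG
  set mH := coordRep₂ IH IH IH fun g h : H => g * h with hmH
  set F := coordRep₂ IG IH IH fun g h => Φ g h with hF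
  set δ := coordRep IG IH D with hδ
  have h2 : (2 : ℕ∞ω) ≤ ∞ := ENat.LEInfty.out
  have hmG2 : ContDiffAt ℝ 2 (Function.uncurry mG) (a, a) :=
    (contDiffAt_coordRep₂_mul IG G).of_le h2
  have hmH2 : ContDiffAt ℝ 2 (Function.uncurry mH) (b, b) :=
    (contDiffAt_coordRep₂_mul IH H).of_le h2
  have hF2 : ContDiffAt ℝ 2 (Function.uncurry F) (a, b) := (hΦ.contDiffAt_coordRep₂ IG IH).of_le h2
  have hδ2 : ContDiffAt ℝ 2 δ a :=
    (contDiffAt_coordRep IG IH hDs.contMDiffAt hD.map_one).of_le h2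
  have hδa : δ a = b := coordRep_extChartAt_one IG IH hD.map_one
  have hδd : DifferentiableAt ℝ δ a := hδ2.differentiableAt (by norm_num)
  have hid1 : fderiv ℝ (F a) b = ContinuousLinearMap.id ℝ EH :=
    fderiv_coordRep₂_of_one_left IG IH (by simp)
  have hid2 : fderiv ℝ (mH b) b = ContinuousLinearMap.id ℝ EH :=
    fderiv_coordRep₂_of_one_left IH IH one_mul
  have hFb : ∀ᶠ p in 𝓝 a, F p b = b := .of_forall fun p => by
    simp [hF, hb, coordRep₂, -extChartAt, extChartAt_to_inv]
  have hk : ∀ x y : EG, mixedDeriv (fun p q => mH (δ p) (F p (δ q))) a a x y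
      = mixedDeriv mH b b (fderiv ℝ δ a x) (fderiv ℝ δ a y)
        + mixedDeriv F a b x (fderiv ℝ δ a y) := by
    intro x y
    have h := mixedDeriv_comp_apply (n := mH) hδa hFb hδd hδd hF2 (by rwa [hδa]) x y
    rwa [hδa, hid1, hid2] at h
  have hcross : ∀ᶠ z in 𝓝 (a, a), δ (mG z.1 z.2) = mH (δ z.1) (F z.1 (δ z.2)) := by
    have hDc : Tendsto D (𝓝 1) (𝓝 1) := by
      have := hDs.continuous.tendsto 1
      rwa [hD.map_one] at this
    have hs := tendsto_extChartAt_symm_one IG G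
    have t1 : Tendsto (fun z : EG × EG => (extChartAt IG (1 : G)).symm z.1) (𝓝 (a, a)) (𝓝 1) := by
      rw [nhds_prod_eq]; exact hs.comp tendsto_fst
    have t2 : Tendsto (fun z : EG × EG => (extChartAt IG (1 : G)).symm z.2) (𝓝 (a, a)) (𝓝 1) := by
      rw [nhds_prod_eq]; exact hs.comp tendsto_snd
    have t3 : Tendsto (fun z : EG × EG => Φ ((extChartAt IG (1 : G)).symm z.1)
        (D ((extChartAt IG (1 : G)).symm z.2))) (𝓝 (a, a)) (𝓝 1) := by
      have h := (hΦ.continuous.tendsto (1, 1)).comp (t1.prodMk_nhds (hDc.comp t2))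
      simpa [Function.comp_def] using h
    filter_upwards [(tendsto_coord_mul IG).eventually (eventually_extChartAt_symm_left_inv IG G),
      (hDc.comp t1).eventually (eventually_extChartAt_symm_left_inv IH H),
      (hDc.comp t2).eventually (eventually_extChartAt_symm_left_inv IH H),
      t3.eventually (eventually_extChartAt_symm_left_inv IH H)] with z h1 h2 h3 h4
    simp only [Function.comp_apply] at h2 h3
    simp only [hδ, hmG, hmH, hF, coordRep, coordRep₂, h1, h2, h3, h4, hD _ _]
  have hmG_right : ∀ᶠ p in 𝓝 a, mG p a = p := by
    filter_upwards [eventually_extChartAt_symm_right_inv IG G] with p hp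
    simp only [hmG, ha, coordRep₂, extChartAt_to_inv, mul_one, hp]
  have main : ∀ x y : EG, fderiv ℝ δ a (mixedDeriv mG a a x y - mixedDeriv mG a a y x)
      = mixedDeriv F a b x (fderiv ℝ δ a y) - mixedDeriv F a b y (fderiv ℝ δ a x)
        + (mixedDeriv mH b b (fderiv ℝ δ a x) (fderiv ℝ δ a y)
          - mixedDeriv mH b b (fderiv ℝ δ a y) (fderiv ℝ δ a x)) := by
    intro x y
    rw [fderiv_mixedDeriv_sub (k := fun p q => mH (δ p) (F p (δ q))) hδ2 hmG2 hmG_right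
      (coordRep₂_one_left_eventuallyEq IG IG one_mul) hcross x y, hk, hk]
    abel
  have hd : diffAtOne IG IH D = fderiv ℝ δ a :=
    diffAtOne_eq_fderiv IG IH (hDs.mdifferentiable (by simp) 1) hD.map_one
  rw [bracket_eq_mixedDeriv, bracket_eq_mixedDeriv, hd]
  exact main x y

omit [IG.Boundaryless] [LieGroup IG ∞ G] in
/-- The automorphisms of an action act on the Lie algebra by Lie algebra homomorphisms: an
automorphism is a crossed homomorphism with respect to the trivial action. -/
theorem IsSmoothAction.diffAtOne_lie (hΦ : IsSmoothAction IG IH Φ) (g : G)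
    (u v : GroupLieAlgebra IH H) :
    diffAtOne IH IH (Φ g) ⁅u, v⁆ = ⁅diffAtOne IH IH (Φ g) u, diffAtOne IH IH (Φ g) v⁆ := by
  have h1 : IsSmoothAction IH IH (1 : H →* MulAut H) := contMDiff_snd
  have hc : IsCrossedHom (1 : H →* MulAut H) (Φ g) := fun a b => by simp
  rw [hc.diffAtOne_lie IH IH h1 (hΦ.contMDiff_apply IG IH g), actionDeriv_one, actionDeriv_one]
  simp

omit [IG.Boundaryless] [IH.Boundaryless] [LieGroup IG ∞ G] [LieGroup IH ∞ H] in
theorem IsSmoothAction.linearizedAction_mul (hΦ : IsSmoothAction IG IH Φ) (g h : G) :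
    linearizedAction IH Φ (g * h)
      = (linearizedAction IH Φ g).comp (linearizedAction IH Φ h) := by
  have hg := (hΦ.contMDiff_apply IG IH g).mdifferentiable (by simp)
  have hh := (hΦ.contMDiff_apply IG IH h).mdifferentiable (by simp)
  have e : (Φ (g * h) : H → H) = Φ g ∘ Φ h := by ext; simp
  have h1 := mfderiv_comp (1 : H) (hg (Φ h 1)) (hh 1)
  have h2 : (mfderiv IH IH (Φ g) (Φ h 1) : EH →L[ℝ] EH) = mfderiv IH IH (Φ g) 1 := by
    rw [_root_.map_one]
  unfold linearizedAction diffAtOne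
  rw [e]
  exact h1.trans (congrArg (fun A : EH →L[ℝ] EH => A.comp (mfderiv IH IH (Φ h) 1)) h2)

omit [TopologicalSpace G] [ChartedSpace HG G] [IH.Boundaryless] [LieGroup IG ∞ G]
  [LieGroup IH ∞ H] in
theorem linearizedAction_one (Φ : G →* MulAut H) :
    linearizedAction IH Φ 1 = ContinuousLinearMap.id ℝ EH := by
  have e : (Φ 1 : H → H) = id := by ext; simp
  unfold linearizedAction diffAtOne
  rw [e]
  exact mfderiv_id

/-- The differential of an action is compatible with brackets: differentiate
`Φ(gh)_* = Φ(g)_* Φ(h)_*` in `h`, then in `g`, and antisymmetrize. -/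
theorem IsSmoothAction.actionDeriv_lie (hΦ : IsSmoothAction IG IH Φ)
    (x y : GroupLieAlgebra IG G) (u : GroupLieAlgebra IH H) :
    actionDeriv IG IH Φ ⁅x, y⁆ u = actionDeriv IG IH Φ x (actionDeriv IG IH Φ y u)
      - actionDeriv IG IH Φ y (actionDeriv IG IH Φ x u) := by
  set a := extChartAt IG (1 : G) 1 with ha
  set b := extChartAt IH (1 : H) 1 with hb
  set mG := coordRep₂ IG IG IG fun g h : G => g * h with hmG
  set F := coordRep₂ IG IH IH fun g h => Φ g h with hF
  set R : EG → EH →L[ℝ] EH := fun p => fderiv ℝ (F p) b with hR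
  have hR_eq : ∀ p, R p = linearizedAction IH Φ ((extChartAt IG (1 : G)).symm p) := fun p =>
    (hΦ.linearizedAction_eq_fderiv IG IH _).symm
  have hmG2 : ContDiffAt ℝ 2 (Function.uncurry mG) (a, a) :=
    (contDiffAt_coordRep₂_mul IG G).of_le ENat.LEInfty.out
  have hR2 : ContDiffAt ℝ 2 R a :=
    (hΦ.contDiffAt_coordRep₂ IG IH).fderiv (m := 2) (g := fun _ => b) contDiffAt_const
      (le_of_eq_of_le (by norm_num) (ENat.LEInfty.out : (3 : ℕ∞ω) ≤ ∞))
  have hN : HasFDerivAt R (mixedDeriv F a b) a :=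
    hasFDerivAt_mixedDeriv ((hΦ.contDiffAt_coordRep₂ IG IH).of_le ENat.LEInfty.out)
  have hk : ∀ x y : EG, mixedDeriv (fun p q => (R p).comp (R q)) a a x y
      = (mixedDeriv F a b x).comp (mixedDeriv F a b y) := by
    intro x y
    have e : (fun p => fderiv ℝ (fun q => (R p).comp (R q)) a)
        = fun p => (ContinuousLinearMap.compL ℝ EH EH EH (R p)).comp (mixedDeriv F a b) := by
      funext p
      exact ((ContinuousLinearMap.compL ℝ EH EH EH (R p)).hasFDerivAt.comp a hN).fderiv
    have hd := (((ContinuousLinearMap.compL ℝ EH EH EH).hasFDerivAt.comp a hN).clm_comp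
      (hasFDerivAt_const (mixedDeriv F a b) a))
    simp only [Function.comp_apply] at hd
    rw [mixedDeriv, e, hd.fderiv]
    ext u
    simp
  have hmul : ∀ᶠ z in 𝓝 (a, a), R (mG z.1 z.2) = (R z.1).comp (R z.2) := by
    filter_upwards [(tendsto_coord_mul IG).eventually (eventually_extChartAt_symm_left_inv IG G)]
      with z hz
    rw [hR_eq, hR_eq, hR_eq, ← hΦ.linearizedAction_mul IG IH]
    simp only [hmG, coordRep₂, hz]
  have hmG_right : ∀ᶠ p in 𝓝 a, mG p a = p := by
    filter_upwards [eventually_extChartAt_symm_right_inv IG G] with p hp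
    simp only [hmG, ha, coordRep₂, extChartAt_to_inv, mul_one, hp]
  have main : ∀ x y : EG, mixedDeriv F a b (mixedDeriv mG a a x y - mixedDeriv mG a a y x)
      = (mixedDeriv F a b x).comp (mixedDeriv F a b y)
        - (mixedDeriv F a b y).comp (mixedDeriv F a b x) := by
    intro x y
    rw [← hN.fderiv, fderiv_mixedDeriv_sub (k := fun p q => (R p).comp (R q)) hR2 hmG2 hmG_right
      (coordRep₂_one_left_eventuallyEq IG IG one_mul) hmul x y, hk, hk, hN.fderiv]
  rw [bracket_eq_mixedDeriv]
  exact congrArg (fun A : EH →L[ℝ] EH => A u) (main x y)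

/-- The differential of an action takes values in derivations: differentiate
`Φ(g)_* [u, v] = [Φ(g)_* u, Φ(g)_* v]` in `g`. -/
theorem IsSmoothAction.actionDeriv_apply_lie (hΦ : IsSmoothAction IG IH Φ)
    (x : GroupLieAlgebra IG G) (u v : GroupLieAlgebra IH H) :
    actionDeriv IG IH Φ x ⁅u, v⁆
      = ⁅actionDeriv IG IH Φ x u, v⁆ + ⁅u, actionDeriv IG IH Φ x v⁆ := by
  set a := extChartAt IG (1 : G) 1 with ha
  set b := extChartAt IH (1 : H) 1 with hb
  set F := coordRep₂ IG IH IH fun g h => Φ g h with hF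
  set M := mixedDeriv (coordRep₂ IH IH IH fun g h : H => g * h) b b with hM
  set R : EG → EH →L[ℝ] EH := fun p => fderiv ℝ (F p) b with hR
  have hR_eq : ∀ p, R p = linearizedAction IH Φ ((extChartAt IG (1 : G)).symm p) := fun p =>
    (hΦ.linearizedAction_eq_fderiv IG IH _).symm
  have hN : HasFDerivAt R (mixedDeriv F a b) a :=
    hasFDerivAt_mixedDeriv ((hΦ.contDiffAt_coordRep₂ IG IH).of_le ENat.LEInfty.out)
  have hRa : R a = ContinuousLinearMap.id ℝ EH := by
    rw [hR_eq, ha, extChartAt_to_inv, linearizedAction_one]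
  have key : ∀ (x : EG) (u v : EH), mixedDeriv F a b x (M u v - M v u)
      = (M (mixedDeriv F a b x u) v - M v (mixedDeriv F a b x u))
        + (M u (mixedDeriv F a b x v) - M (mixedDeriv F a b x v) u) := by
    intro x u v
    have hRu : ∀ u, HasFDerivAt (fun p => R p u) ((mixedDeriv F a b).flip u) a := fun u => by
      have h := hN.clm_apply (hasFDerivAt_const u a)
      refine h.congr_fderiv ?_
      ext; simp
    have hMM : ∀ u v, HasFDerivAt (fun p => M (R p u) (R p v)) _ a := fun u v =>
      (M.hasFDerivAt.comp a (hRu u)).clm_apply (hRu v)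
    -- This holds for every `p`, since `R p` is the differential of an automorphism of `H`.
    have e : (fun p => R p (M u v - M v u))
        = fun p => M (R p u) (R p v) - M (R p v) (R p u) := by
      funext p
      have h := hΦ.diffAtOne_lie IG IH ((extChartAt IG (1 : G)).symm p) u v
      rw [hR_eq]
      exact (congrArg (linearizedAction IH Φ ((extChartAt IG (1 : G)).symm p))
        (bracket_eq_mixedDeriv IH u v).symm).trans (h.trans (bracket_eq_mixedDeriv IH _ _))
    have h1 := hRu (M u v - M v u)
    rw [e] at h1
    have h2 := congrArg (fun A : EG →L[ℝ] EH => A x)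
      (h1.unique ((hMM u v).sub (hMM v u)))
    simp [hRa] at h2
    rw [map_sub, h2]
    abel
  rw [bracket_eq_mixedDeriv, bracket_eq_mixedDeriv, bracket_eq_mixedDeriv]
  exact key x u v

/-- The derived action has differential `x ↦ Φ_*(x) + [d(x), ·]`: compare the mixed second
derivatives of the two sides of `Φ_D(g)(h) D(g) = D(g) Φ(g)(h)`. -/
theorem IsCrossedHom.actionDeriv_derivedAction (hD : IsCrossedHom Φ D)
    (hΦ : IsSmoothAction IG IH Φ) (hDs : ContMDiff IG IH ∞ D)
    (hΦD : IsSmoothAction IG IH (derivedAction Φ D hD))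
    (x : GroupLieAlgebra IG G) (u : GroupLieAlgebra IH H) :
    actionDeriv IG IH (derivedAction Φ D hD) x u
      = actionDeriv IG IH Φ x u + ⁅diffAtOne IG IH D x, u⁆ := by
  set a := extChartAt IG (1 : G) 1 with ha
  set b := extChartAt IH (1 : H) 1 with hb
  set mH := coordRep₂ IH IH IH fun g h : H => g * h with hmH
  set F := coordRep₂ IG IH IH fun g h => Φ g h with hF
  set F' := coordRep₂ IG IH IH fun g h => derivedAction Φ D hD g h with hF'
  set δ := coordRep IG IH D with hδ
  have h2 : (2 : ℕ∞ω) ≤ ∞ := ENat.LEInfty.out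
  have hmH2 : ContDiffAt ℝ 2 (Function.uncurry mH) (b, b) :=
    (contDiffAt_coordRep₂_mul IH H).of_le h2
  have hF2 : ContDiffAt ℝ 2 (Function.uncurry F) (a, b) := (hΦ.contDiffAt_coordRep₂ IG IH).of_le h2
  have hF'2 : ContDiffAt ℝ 2 (Function.uncurry F') (a, b) :=
    (hΦD.contDiffAt_coordRep₂ IG IH).of_le h2
  have hδa : δ a = b := coordRep_extChartAt_one IG IH hD.map_one
  have hδd : DifferentiableAt ℝ δ a :=
    (contDiffAt_coordRep IG IH hDs.contMDiffAt hD.map_one).differentiableAt (by simp)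
  have hFid : fderiv ℝ (F a) b = ContinuousLinearMap.id ℝ EH :=
    fderiv_coordRep₂_of_one_left IG IH (by simp)
  have hF'id : fderiv ℝ (F' a) b = ContinuousLinearMap.id ℝ EH :=
    fderiv_coordRep₂_of_one_left IG IH (by simp)
  have hleft : fderiv ℝ (mH b) b = ContinuousLinearMap.id ℝ EH :=
    fderiv_coordRep₂_of_one_left IH IH one_mul
  have hright : fderiv ℝ (fun q => mH q b) b = ContinuousLinearMap.id ℝ EH :=
    fderiv_coordRep₂_of_one_left (f := fun g h : H => h * g) IH IH mul_one
  have hFb : ∀ᶠ p in 𝓝 a, F p b = b := .of_forall fun p => by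
    simp [hF, hb, coordRep₂, -extChartAt, extChartAt_to_inv]
  have hF'b : ∀ᶠ p in 𝓝 a, F' p b = b := .of_forall fun p => by
    simp [hF', hb, coordRep₂, -extChartAt, extChartAt_to_inv]
  have hev : ∀ᶠ z in 𝓝 (a, b), mH (F' z.1 (id z.2)) (δ z.1) = mH (δ z.1) (F z.1 (id z.2)) := by
    have hDc : Tendsto D (𝓝 1) (𝓝 1) := by
      have := hDs.continuous.tendsto 1
      rwa [hD.map_one] at this
    have t1 : Tendsto (fun z : EG × EH => (extChartAt IG (1 : G)).symm z.1) (𝓝 (a, b)) (𝓝 1) := by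
      rw [nhds_prod_eq]; exact (tendsto_extChartAt_symm_one IG G).comp tendsto_fst
    have t2 : Tendsto (fun z : EG × EH => (extChartAt IH (1 : H)).symm z.2) (𝓝 (a, b)) (𝓝 1) := by
      rw [nhds_prod_eq]; exact (tendsto_extChartAt_symm_one IH H).comp tendsto_snd
    have t3 : ∀ Ψ : G →* MulAut H, IsSmoothAction IG IH Ψ →
        Tendsto (fun z : EG × EH => Ψ ((extChartAt IG (1 : G)).symm z.1)
          ((extChartAt IH (1 : H)).symm z.2)) (𝓝 (a, b)) (𝓝 1) := by
      intro Ψ hΨ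
      have h := (hΨ.continuous.tendsto (1, 1)).comp (t1.prodMk_nhds t2)
      simpa [Function.comp_def] using h
    filter_upwards [(hDc.comp t1).eventually (eventually_extChartAt_symm_left_inv IH H),
      (t3 _ hΦ).eventually (eventually_extChartAt_symm_left_inv IH H),
      (t3 _ hΦD).eventually (eventually_extChartAt_symm_left_inv IH H)] with z h1 h2 h3
    simp only [Function.comp_apply] at h1
    simp only [hδ, hmH, hF, hF', coordRep, coordRep₂, h1, h2, h3, id]
    simp [derivedAction_apply]
  have key : ∀ (x : EG) (u : EH), mixedDeriv F' a b x u = mixedDeriv F a b x u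
      + (mixedDeriv mH b b (fderiv ℝ δ a x) u - mixedDeriv mH b b u (fderiv ℝ δ a x)) := by
    intro x u
    have e1 := mixedDeriv_comp_apply (n := fun p q => mH q p) (ε := id) (e := b) (b := b) rfl hF'b
      hδd differentiableAt_id hF'2 (by rw [hδa]; exact contDiffAt_swap hmH2) x u
    have e2 := mixedDeriv_comp_apply (n := mH) (ε := id) (e := b) (b := b) rfl hFb
      hδd differentiableAt_id hF2 (by rwa [hδa]) x u
    rw [mixedDeriv_congr (F' := fun p q => mH (δ p) (F p (id q))) hev, e2, hδa, hFid, hF'id,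
      hleft, fderiv_id, hright] at e1
    simp only [ContinuousLinearMap.id_apply] at e1
    rw [mixedDeriv_swap_apply hmH2] at e1
    rw [eq_sub_of_add_eq' e1.symm]
    abel
  have hd : diffAtOne IG IH D = fderiv ℝ δ a :=
    diffAtOne_eq_fderiv IG IH (hDs.mdifferentiable (by simp) 1) hD.map_one
  rw [bracket_eq_mixedDeriv, hd]
  exact key x u

/-- Differentiate `D(g) D(g)⁻¹ = 1` in charts: at `(1, 1)` the differential of the multiplication is
the addition. -/
theorem diffAtOne_inv (h1 : D 1 = 1) (hDs : ContMDiff IG IH ∞ D) :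
    diffAtOne IG IH (fun g => (D g)⁻¹) = -diffAtOne IG IH D := by
  set a := extChartAt IG (1 : G) 1 with ha
  set b := extChartAt IH (1 : H) 1 with hb
  set U := Function.uncurry (coordRep₂ IH IH IH fun g h : H => g * h) with hU
  set δ := coordRep IG IH D with hδ
  set δ' := coordRep IG IH (fun g => (D g)⁻¹) with hδ'
  have h1' : (fun g => (D g)⁻¹) 1 = 1 := by simp [h1]
  have hδa : δ a = b := coordRep_extChartAt_one IG IH h1
  have hδ'a : δ' a = b := coordRep_extChartAt_one IG IH h1'
  have hδd : DifferentiableAt ℝ δ a :=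
    (contDiffAt_coordRep IG IH hDs.contMDiffAt h1).differentiableAt (by simp)
  have hδ'd : DifferentiableAt ℝ δ' a :=
    (contDiffAt_coordRep IG IH hDs.inv.contMDiffAt h1').differentiableAt (by simp)
  have hUd : HasFDerivAt U (fderiv ℝ U (b, b)) (b, b) :=
    ((contDiffAt_coordRep₂_mul IH H).differentiableAt (by simp)).hasFDerivAt
  have hleft : (fderiv ℝ U (b, b)).comp (ContinuousLinearMap.inr ℝ EH EH)
      = ContinuousLinearMap.id ℝ EH :=
    (hUd.comp (f := fun q : EH => (b, q)) b (hasFDerivAt_prodMk_right b b)).fderiv.symm.trans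
      (fderiv_coordRep₂_of_one_left IH IH one_mul)
  have hright : (fderiv ℝ U (b, b)).comp (ContinuousLinearMap.inl ℝ EH EH)
      = ContinuousLinearMap.id ℝ EH :=
    (hUd.comp (f := fun p : EH => (p, b)) b (hasFDerivAt_prodMk_left b b)).fderiv.symm.trans
      (fderiv_coordRep₂_of_one_left (f := fun g h : H => h * g) IH IH mul_one)
  have hconst : (fun p => U (δ p, δ' p)) =ᶠ[𝓝 a] fun _ => b := by
    have hc : ∀ f : G → H, ContMDiff IG IH ∞ f → f 1 = 1 → ∀ᶠ p in 𝓝 a,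
        (extChartAt IH (1 : H)).symm (coordRep IG IH f p)
          = f ((extChartAt IG (1 : G)).symm p) := by
      intro f hf hf1
      have t := (hf.continuous.tendsto 1).comp (tendsto_extChartAt_symm_one IG G)
      rw [hf1] at t
      exact t.eventually (eventually_extChartAt_symm_left_inv IH H)
    filter_upwards [hc D hDs h1, hc _ hDs.inv h1'] with p hp hp'
    simp only [hU, Function.uncurry, coordRep₂, hδ, hδ', hp, hp', hb, mul_inv_cancel]
  have hsum : fderiv ℝ δ a + fderiv ℝ δ' a = 0 := by
    have h := (HasFDerivAt.comp (g := U) (f := fun p => (δ p, δ' p)) a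
      (by rw [hδa, hδ'a]; exact hUd) (hδd.hasFDerivAt.prodMk hδ'd.hasFDerivAt)).fderiv
    have h0 : fderiv ℝ (U ∘ fun p => (δ p, δ' p)) a = 0 :=
      (EventuallyEq.fderiv_eq hconst).trans (fderiv_const_apply _)
    rw [h0] at h
    ext x
    have hx := congrArg (fun A : EG →L[ℝ] EH => A x) h
    have hl := congrArg (fun A : EH →L[ℝ] EH => A (fderiv ℝ δ' a x)) hleft
    have hr := congrArg (fun A : EH →L[ℝ] EH => A (fderiv ℝ δ a x)) hright
    simp only [ContinuousLinearMap.comp_apply, ContinuousLinearMap.inl_apply,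
      ContinuousLinearMap.inr_apply, ContinuousLinearMap.id_apply] at hl hr
    have hs : ((fderiv ℝ δ a x, fderiv ℝ δ' a x) : EH × EH)
        = (fderiv ℝ δ a x, 0) + (0, fderiv ℝ δ' a x) := by simp
    simp only [ContinuousLinearMap.comp_apply, ContinuousLinearMap.prod_apply, hs, map_add,
      hl, hr] at hx
    exact hx.symm
  have e1 : diffAtOne IG IH D = fderiv ℝ δ a :=
    diffAtOne_eq_fderiv IG IH (hDs.mdifferentiable (by simp) 1) h1
  have e2 : diffAtOne IG IH (fun g => (D g)⁻¹) = fderiv ℝ δ' a :=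
    diffAtOne_eq_fderiv IG IH (hDs.inv.mdifferentiable (by simp) 1) h1'
  rw [e1, e2]
  exact eq_neg_of_add_eq_zero_right hsum

end Differential

end CrossedHom

/-! ### The Lie algebra homomorphism `Φ_*` -/

namespace CrossedHom

section Differential

variable {EG : Type*} [NormedAddCommGroup EG] [NormedSpace ℝ EG] [CompleteSpace EG]
  {HG : Type*} [TopologicalSpace HG] (IG : ModelWithCorners ℝ EG HG) [IG.Boundaryless]
  {EH : Type*} [NormedAddCommGroup EH] [NormedSpace ℝ EH] [CompleteSpace EH]
  {HH : Type*} [TopologicalSpace HH] (IH : ModelWithCorners ℝ EH HH) [IH.Boundaryless]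
  {G : Type*} [TopologicalSpace G] [ChartedSpace HG G] [Group G] [LieGroup IG ∞ G]
  {H : Type*} [TopologicalSpace H] [ChartedSpace HH H] [Group H] [LieGroup IH ∞ H]
  {Φ : G →* MulAut H} {D : G → H}

/-- The differential `Φ_* : 𝔤 → Der(𝔥)` of a smooth action, as a Lie algebra homomorphism. -/
noncomputable def IsSmoothAction.differential (hΦ : IsSmoothAction IG IH Φ) :
    GroupLieAlgebra IG G →ₗ⁅ℝ⁆
      LieDerivation ℝ (GroupLieAlgebra IH H) (GroupLieAlgebra IH H) where
  toFun x :=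
    { toLinearMap := (actionDeriv IG IH Φ x).toLinearMap
      leibniz' := fun u v => by
        change actionDeriv IG IH Φ x ⁅u, v⁆
          = ⁅u, actionDeriv IG IH Φ x v⁆ - ⁅v, actionDeriv IG IH Φ x u⁆
        rw [hΦ.actionDeriv_apply_lie IG IH, ← lie_skew v, sub_neg_eq_add, add_comm] }
  map_add' x y := by
    ext u
    exact congrArg (fun A : GroupLieAlgebra IH H →L[ℝ] GroupLieAlgebra IH H => A u)
      (map_add (actionDeriv IG IH Φ) x y)
  map_smul' c x := by
    ext u
    exact congrArg (fun A : GroupLieAlgebra IH H →L[ℝ] GroupLieAlgebra IH H => A u)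
      (map_smul (actionDeriv IG IH Φ) c x)
  map_lie' {x y} := by
    ext u
    rw [LieDerivation.lie_apply]
    exact hΦ.actionDeriv_lie IG IH x y u

/-- Since `g ↦ Φ(g)_*` is differentiable at the identity with derivative `actionDeriv`, any
homomorphism into derivations with the same values is the differential of the action. -/
theorem IsSmoothAction.isActionDifferential (hΦ : IsSmoothAction IG IH Φ)
    {φ : GroupLieAlgebra IG G →ₗ⁅ℝ⁆
      LieDerivation ℝ (GroupLieAlgebra IH H) (GroupLieAlgebra IH H)}
    (hφ : ∀ x u, φ x u = actionDeriv IG IH Φ x u) : IsActionDifferential IG IH Φ φ := by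
  have h := hΦ.hasMFDerivAt_linearizedAction IG IH
  refine ⟨h.mdifferentiableAt, fun x u => ?_⟩
  rw [h.mfderiv]
  exact hφ x u

omit [IG.Boundaryless] [IH.Boundaryless] [LieGroup IG ∞ G] [CompleteSpace EG] [CompleteSpace EH] in
theorem IsSmoothAction.derivedAction (hΦ : IsSmoothAction IG IH Φ) (hDs : ContMDiff IG IH ∞ D)
    (hD : IsCrossedHom Φ D) : IsSmoothAction IG IH (CrossedHom.derivedAction Φ D hD) :=
  ((hDs.comp contMDiff_fst).mul hΦ).mul (hDs.comp contMDiff_fst).inv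

end Differential

end CrossedHom

open CrossedHom in
theorem theorem4p2
    {EG : Type*} [NormedAddCommGroup EG] [NormedSpace ℝ EG] [FiniteDimensional ℝ EG]
    {HG : Type*} [TopologicalSpace HG] (IG : ModelWithCorners ℝ EG HG) [IG.Boundaryless]
    {EH : Type*} [NormedAddCommGroup EH] [NormedSpace ℝ EH] [FiniteDimensional ℝ EH]
    {HH : Type*} [TopologicalSpace HH] (IH : ModelWithCorners ℝ EH HH) [IH.Boundaryless]
    {G : Type*} [TopologicalSpace G] [ChartedSpace HG G] [Group G] [LieGroup IG ∞ G]
    {H : Type*} [TopologicalSpace H] [ChartedSpace HH H] [Group H] [LieGroup IH ∞ H]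
    (Φ : G →* MulAut H) (hΦ : IsSmoothAction IG IH Φ)
    (D : G → H) (hDsmooth : ContMDiff IG IH ∞ D) (hD : IsCrossedHom Φ D)
    (d : GroupLieAlgebra IG G →ₗ[ℝ] GroupLieAlgebra IH H)
    (hd : d = (diffAtOne IG IH D).toLinearMap) :
    ∃ (φ : GroupLieAlgebra IG G →ₗ⁅ℝ⁆
          LieDerivation ℝ (GroupLieAlgebra IH H) (GroupLieAlgebra IH H))
      (hc : IsLieCrossedHom φ d),
      IsActionDifferential IG IH Φ φ ∧
      IsSmoothAction IG IH (derivedAction Φ D hD) ∧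
      IsActionDifferential IG IH (derivedAction Φ D hD) (derivedLieAction φ d hc) ∧
      ContMDiff IG IH ∞ (fun g => (D g)⁻¹) ∧
      IsCrossedHom (derivedAction Φ D hD) (fun g => (D g)⁻¹) ∧
      (diffAtOne IG IH (fun g => (D g)⁻¹)).toLinearMap = -d ∧
      IsLieCrossedHom (derivedLieAction φ d hc) (-d) := by
  have h1 : D 1 = 1 := hD.map_one
  have hΦD : IsSmoothAction IG IH (derivedAction Φ D hD) := hΦ.derivedAction IG IH hDsmooth hD
  have hc : IsLieCrossedHom (hΦ.differential IG IH) d := by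
    subst hd
    exact hD.diffAtOne_lie IG IH hΦ hDsmooth
  refine ⟨hΦ.differential IG IH, hc, hΦ.isActionDifferential IG IH fun _ _ => rfl, hΦD,
    hΦD.isActionDifferential IG IH fun x u => ?_, hDsmooth.inv, hD.inv, ?_, hc.neg⟩
  · rw [hD.actionDeriv_derivedAction IG IH hΦ hDsmooth hΦD, derivedLieAction_apply, hd]
    rfl
  · rw [diffAtOne_inv IG IH h1 hDsmooth, hd]
    rfl
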